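/- Fix $n\in\mathbb N$. Vocabularies consist of relation symbols only, of arbitrary finite arities. The formulas of the logic $\mathcal U_n$ are the formulas of first-order logic with equality in which only the individual variables $v_0,\dots,v_{n-1}$ occur (equality and falsum are logical symbols and do not count as relation symbols). For a set $A$, a subset $U_0\subseteq A$ and $\bar s,\bar z\in A^k$ write $\bar s\sim\bar z$ if for all $i,j<k$ we have $s_i=s_j\Leftrightarrow z_i=z_j$, and for all $i<k$ we have $s_i\in U_0\Leftrightarrow z_i\in U_0$. A *$U$-structure* is a relational structure $\mathcal A$ with non-empty universe $A$, together with a subset $U_0\subseteq A$ (its *core*, which is not a basic relation and has no name in the vocabulary), such that $|U_0|\ge n$, $|A\setminus U_0|\ge n$, and for every $k$-ary basic relation $R$, if $\bar s\in R$ and $\bar s\sim\bar z$ then $\bar z\in R$. "Definable" means definable without parameters by a formula of $\mathcal U_n$; a definable $m$-ary relation (with $m\le n$) is one defined by a formula with free variables among $v_0,\dots,v_{m-1}$. A $U$-structure $\mathcal A$ is *strong* if, for every sub-vocabulary $V$ such that $U_0$ is not definable in the reduct $\mathcal A|_V$, every $m\le n$, every $m$-ary relation $R$ definable in $\mathcal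 A|_V$ all of whose members are tuples with pairwise distinct entries, and all distinct $i,j<m$, the following holds for every $\bar s\in A^m$: $\bar s\in R$ if and only if the entries of $\bar s$ are pairwise distinct, some tuple of $R$ differs from $\bar s$ at most in the $i$-th entry, and some tuple of $R$ differs from $\bar s$ at most in the $j$-th entry. The models of $\mathcal U_n$ are the strong $U$-structures, with the usual first-order satisfaction. A formula is *valid* in $\mathcal A$ if it is satisfied by every evaluation of the variables in $A$, and $\varphi\models\psi$ means that $\psi$ is valid in every strong $U$-structure in which $\varphi$ is valid. **Theorem.** The logic $\mathcal U_n$ has the Weak Craig Interpolation Property: for all formulas $\varphi,\psi$ of $\mathcal U_n$ with $\varphi\models\psi$ there is a formula $\vartheta$ of $\mathcal U_n$ such that $\varphi\models\vartheta$ and $\vartheta\models\psi$, and every relation symbol occurring in $\vartheta$ occurs both in $\varphi$ and in $\psi$. -/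

import Mathlib

universe u v w

namespace UnaryLogic

/-- The vocabulary determined by `L`: all its relation symbols, of all (finite) arities. -/
abbrev Symb (L : FirstOrder.Language.{u, v}) : Type v := Σ k : ℕ, L.Relations k

/-- Formulas of first-order logic with equality over the relation symbols of `L` in which only the
individual variables `v_0, …, v_{n-1}` occur, free or bound. -/
inductive NFormula (L : FirstOrder.Language.{u, v}) (n : ℕ) : Type v
  | falsum : NFormula L n
  | equal (i j : Fin n) : NFormula L n
  | rel {k : ℕ} (R : L.Relations k) (t : Fin k → Fin n) : NFormula L n
  | imp (φ ψ : NFormula L n) : NFormula L n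
  | all (i : Fin n) (φ : NFormula L n) : NFormula L n

namespace NFormula

variable {L : FirstOrder.Language.{u, v}} {n : ℕ}

/-- Satisfaction `A ⊨ φ[s]`, where the variable `v_i` is evaluated as `s i`. -/
def Realize {A : Type w} [L.Structure A] : NFormula L n → (Fin n → A) → Prop
  | falsum, _ => False
  | equal i j, s => s i = s j
  | rel R t, s => FirstOrder.Language.Structure.RelMap R (fun x => s (t x))
  | imp φ ψ, s => φ.Realize s → ψ.Realize s
  | all i φ, s => ∀ a : A, φ.Realize (Function.update s i a)

/-- The set of relation symbols occurring in a formula. Equality is a logical symbol and is not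
counted. -/
def voc : NFormula L n → Set (Symb L)
  | falsum => ∅
  | equal _ _ => ∅
  | rel R _ => {⟨_, R⟩}
  | imp φ ψ => φ.voc ∪ ψ.voc
  | all _ φ => φ.voc

/-- `φ` is valid in `A`: it holds under every evaluation of the variables. -/
def ValidIn (φ : NFormula L n) (A : Type w) [L.Structure A] : Prop :=
  ∀ s : Fin n → A, φ.Realize s

end NFormula

/-- The relation `s ∼ z` on `k`-tuples of `A` with respect to `U₀ ⊆ A`: the two tuples have the
same kernel, and their corresponding entries lie in `U₀` simultaneously. -/
def Sim {A : Type w} (U₀ : Set A) {k : ℕ} (s z : Fin k → A) : Prop :=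
  (∀ i j, s i = s j ↔ z i = z j) ∧ ∀ i, s i ∈ U₀ ↔ z i ∈ U₀

/-- The `L`-structure on `A`, together with the core `U₀`, is a `U`-structure (for `n`). The core
is not a basic relation: formulas do not speak about it. -/
structure IsUStructure (L : FirstOrder.Language.{u, v}) (n : ℕ) {A : Type w} [L.Structure A]
    (U₀ : Set A) : Prop where
  le_core : (n : ℕ∞) ≤ U₀.encard
  le_compl : (n : ℕ∞) ≤ U₀ᶜ.encard
  closed : ∀ {k : ℕ} (R : L.Relations k) (s z : Fin k → A),
    FirstOrder.Language.Structure.RelMap R s → Sim U₀ s z → FirstOrder.Language.Structure.RelMap R z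

/-- The `m`-ary relation `X` on `A` is definable, without parameters, by an `n`-variable formula in
the reduct of `A` to the sub-vocabulary `V`: `m ≤ n` and some formula `φ(v_0, …, v_{m-1})` over `V`
defines `X`. That the remaining variables are not free in `φ` is expressed by saying that the truth
of `φ` does not depend on them (they may be quantified away). -/
def DefinableOver {L : FirstOrder.Language.{u, v}} (n : ℕ) (V : Set (Symb L)) {A : Type w} [L.Structure A]
    {m : ℕ} (X : Set (Fin m → A)) : Prop :=
  ∃ (h : m ≤ n) (φ : NFormula L n), φ.voc ⊆ V ∧
    ∀ s : Fin n → A, φ.Realize s ↔ (fun i : Fin m => s (Fin.castLE h i)) ∈ X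

/-- The subset `U₀` of `A` as a unary relation is definable over `V`. -/
def CoreDefinableOver {L : FirstOrder.Language.{u, v}} (n : ℕ) (V : Set (Symb L)) {A : Type w}
    [L.Structure A] (U₀ : Set A) : Prop :=
  DefinableOver n V {x : Fin 1 → A | x 0 ∈ U₀}

/-- Strong `U`-structures: whenever the core is not definable in the reduct to `V`, every relation
`X` definable in that reduct and consisting of `m`-tuples with pairwise distinct entries satisfies
`X ↔ ∃ v_i X ∧ ∃ v_j X ∧ "v_0, …, v_{m-1} are pairwise distinct"` for all distinct `i, j < m`. -/
structure IsStrongUStructure (L : FirstOrder.Language.{u, v}) (n : ℕ) {A : Type w} [L.Structure A]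
    (U₀ : Set A) : Prop extends IsUStructure L n U₀ where
  strong : ∀ V : Set (Symb L), ¬ CoreDefinableOver n V U₀ →
    ∀ (m : ℕ) (X : Set (Fin m → A)), DefinableOver n V X →
      (∀ s ∈ X, Function.Injective s) →
      ∀ i j : Fin m, i ≠ j → ∀ s : Fin m → A,
        s ∈ X ↔ (∃ a, Function.update s i a ∈ X) ∧ (∃ a, Function.update s j a ∈ X) ∧
          Function.Injective s

/-- Semantical consequence `φ ⊨ ψ` of the logic `U_n`: `ψ` is valid in every strong `U`-structure
(with non-empty universe) in which `φ` is valid. -/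
def Entails {L : FirstOrder.Language.{u, v}} {n : ℕ} (φ ψ : NFormula L n) : Prop :=
  ∀ (A : Type w) [Nonempty A] [L.Structure A] (U₀ : Set A), IsStrongUStructure L n U₀ →
    φ.ValidIn A → ψ.ValidIn A

end UnaryLogic

/-!
In a `U`-structure the truth of an `n`-variable formula at a tuple depends only on the type of the
tuple: its kernel together with the set of entries lying in the core. Since the core and its
complement have at least `n` elements, tuples of the same type in two structures form a
back-and-forth system, so two structures whose atomic formulas over `S` hold at the same types
(`AgreeOn`) satisfy the same formulas over `S` (`IsUStructure.realize_iff`).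

Being strong is a dichotomy: for every sub-vocabulary, either the core is definable over it, or the
truth of its atomic formulas depends on kernels alone (`IsStrongUStructure.atomsTrivial`,
`IsUStructure.isStrong_of_atomsTrivial`). Two consequences carry the proof.

* Any two strong structures `A` and `B` have a strong amalgam that agrees with `A` on a given set of
  symbols and with `B` on all others (`exists_amalgam`): if the core is not definable over `V` in the
  amalgam, then both parts of `V` are trivial.
* Strong structures with the same valid formulas over `V` agree on `V`, possibly after replacing one
  core by its complement (`IsStrongUStructure.agreeOn_or_agreeOn_compl`). If the core of one is
  definable over `V`, types can be described by formulas over `V`; otherwise both are trivial over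
  `V`, and kernels, which can always be described, suffice.

Now let `φ ⊨ ψ`, let `V` be the common vocabulary, `A` a strong model of `φ` and `B` a strong
structure in which `ψ` is not valid. If `A` and `B` had the same valid formulas over `V`, they would
agree on `V`, and their amalgam would satisfy `φ` but not `ψ`. Hence some formula over `V` separates
them (`exists_separating`). As `V` is finite, there are only finitely many profiles (the sets of
types at which the atomic formulas over `V` hold), and a profile determines validity over `V`. The
interpolant is the disjunction, over the profiles of models of `φ`, of the conjunction, over the
profiles of structures refuting `ψ`, of the universal closures of the separating formulas.
-/

namespace UnaryLogic

open FirstOrder.Language (Structure)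
open FirstOrder.Language.Structure (RelMap)

universe w₁ w₂ w₃

namespace NFormula

variable {L : FirstOrder.Language.{u, v}} {n : ℕ} {A : Type w} [L.Structure A]

/-! ### Derived connectives -/

/-- Negation. -/
def neg (φ : NFormula L n) : NFormula L n := φ.imp falsum

/-- Conjunction of two formulas. -/
def and (φ ψ : NFormula L n) : NFormula L n := (φ.imp ψ.neg).neg

/-- Existential quantification over the variable `v_i`. -/
def ex (i : Fin n) (φ : NFormula L n) : NFormula L n := (all i φ.neg).neg

@[simp] lemma realize_neg (φ : NFormula L n) (s : Fin n → A) :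
    φ.neg.Realize s ↔ ¬ φ.Realize s := Iff.rfl

@[simp] lemma realize_imp (φ ψ : NFormula L n) (s : Fin n → A) :
    (φ.imp ψ).Realize s ↔ (φ.Realize s → ψ.Realize s) := Iff.rfl

@[simp] lemma realize_falsum (s : Fin n → A) :
    (falsum : NFormula L n).Realize s ↔ False := Iff.rfl

@[simp] lemma realize_equal (i j : Fin n) (s : Fin n → A) :
    (equal i j : NFormula L n).Realize s ↔ s i = s j := Iff.rfl

lemma realize_rel {k : ℕ} (R : L.Relations k) (t : Fin k → Fin n) (s : Fin n → A) :
    (rel R t).Realize s ↔ RelMap R (s ∘ t) := Iff.rfl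

@[simp] lemma realize_and (φ ψ : NFormula L n) (s : Fin n → A) :
    (φ.and ψ).Realize s ↔ φ.Realize s ∧ ψ.Realize s := by
  simp [NFormula.and]

lemma realize_ex (i : Fin n) (φ : NFormula L n) (s : Fin n → A) :
    (ex i φ).Realize s ↔ ∃ a, φ.Realize (Function.update s i a) := by
  simp [ex, Realize]

@[simp] lemma voc_neg (φ : NFormula L n) : φ.neg.voc = φ.voc := by simp [neg, voc]

@[simp] lemma voc_imp (φ ψ : NFormula L n) : (φ.imp ψ).voc = φ.voc ∪ ψ.voc := rfl

@[simp] lemma voc_and (φ ψ : NFormula L n) : (φ.and ψ).voc = φ.voc ∪ ψ.voc := by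
  simp [NFormula.and]

@[simp] lemma voc_ex (i : Fin n) (φ : NFormula L n) : (ex i φ).voc = φ.voc := by
  simp [ex, voc]

lemma finite_voc (φ : NFormula L n) : φ.voc.Finite := by
  induction φ with
  | falsum => exact Set.finite_empty
  | equal i j => exact Set.finite_empty
  | rel R t => exact Set.finite_singleton _
  | imp φ ψ hφ hψ => exact hφ.union hψ
  | all i φ h => exact h

/-- The conjunction of a list of formulas. -/
def listConj (l : List (NFormula L n)) : NFormula L n := l.foldr and falsum.neg

lemma realize_listConj (l : List (NFormula L n)) (s : Fin n → A) :
    (listConj l).Realize s ↔ ∀ φ ∈ l, φ.Realize s := by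
  induction l with
  | nil => simp [listConj]
  | cons φ l ih => simpa [listConj] using fun _ => ih

lemma voc_listConj {V : Set (Symb L)} (l : List (NFormula L n)) (h : ∀ φ ∈ l, φ.voc ⊆ V) :
    (listConj l).voc ⊆ V := by
  induction l with
  | nil => simp [listConj, voc]
  | cons φ l ih =>
    rw [List.forall_mem_cons] at h
    exact (voc_and φ _).trans_subset (Set.union_subset h.1 (ih h.2))

/-- The conjunction of a finite family of formulas. -/
noncomputable def conj {ι : Type*} [Finite ι] (χ : ι → NFormula L n) : NFormula L n :=
  letI := Fintype.ofFinite ι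
  listConj (Finset.univ.toList.map χ)

@[simp] lemma realize_conj {ι : Type*} [Finite ι] (χ : ι → NFormula L n) (s : Fin n → A) :
    (conj χ).Realize s ↔ ∀ i, (χ i).Realize s := by
  simp [conj, realize_listConj]

lemma voc_conj {ι : Type*} [Finite ι] {χ : ι → NFormula L n} {V : Set (Symb L)}
    (h : ∀ i, (χ i).voc ⊆ V) : (conj χ).voc ⊆ V :=
  voc_listConj _ (by simpa using h)

/-- The disjunction of a finite family of formulas. -/
noncomputable def disj {ι : Type*} [Finite ι] (χ : ι → NFormula L n) : NFormula L n :=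
  (conj fun i => (χ i).neg).neg

@[simp] lemma realize_disj {ι : Type*} [Finite ι] (χ : ι → NFormula L n) (s : Fin n → A) :
    (disj χ).Realize s ↔ ∃ i, (χ i).Realize s := by
  simp [disj]

lemma voc_disj {ι : Type*} [Finite ι] {χ : ι → NFormula L n} {V : Set (Symb L)}
    (h : ∀ i, (χ i).voc ⊆ V) : (disj χ).voc ⊆ V :=
  (voc_neg _).trans_subset (voc_conj fun i => (voc_neg _).trans_subset (h i))

/-- The formula `φ` if `p` holds, and its negation otherwise. -/
noncomputable def signed (p : Prop) (φ : NFormula L n) : NFormula L n :=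
  open Classical in if p then φ else φ.neg

@[simp] lemma realize_signed (p : Prop) (φ : NFormula L n) (s : Fin n → A) :
    (signed p φ).Realize s ↔ (p ↔ φ.Realize s) := by
  by_cases p <;> simp [signed, *]

@[simp] lemma voc_signed (p : Prop) (φ : NFormula L n) : (signed p φ).voc = φ.voc := by
  by_cases p <;> simp [signed, *]

/-- The universal quantification of `φ` over all variables in the list `l`. -/
def allList (l : List (Fin n)) (φ : NFormula L n) : NFormula L n := l.foldr all φ

lemma realize_allList (l : List (Fin n)) (φ : NFormula L n) (s : Fin n → A) :
    (allList l φ).Realize s ↔ ∀ z : Fin n → A, (∀ i ∉ l, z i = s i) → φ.Realize z := by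
  induction l generalizing s with
  | nil =>
    refine ⟨fun h z hz => ?_, fun h => h s fun _ _ => rfl⟩
    rwa [show z = s from funext fun i => hz i (by simp)]
  | cons j l ih =>
    change (∀ a, (allList l φ).Realize (Function.update s j a)) ↔ _
    simp only [ih]
    refine ⟨fun h z hz => h (z j) z fun i hi => ?_, fun h a z hz => h z fun i hi => ?_⟩
    · by_cases hij : i = j
      · subst hij; simp
      · rw [Function.update_of_ne hij]
        exact hz i (by simp [hij, hi])
    · rw [List.mem_cons, not_or] at hi
      rw [hz i hi.2, Function.update_of_ne hi.1]

@[simp] lemma voc_allList (l : List (Fin n)) (φ : NFormula L n) :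
    (allList l φ).voc = φ.voc := by
  induction l with
  | nil => rfl
  | cons j l ih => exact ih

/-- The universal closure of a formula. -/
def closure (φ : NFormula L n) : NFormula L n := allList (List.finRange n) φ

/-- The universal closure is a sentence: it holds under some evaluation iff `φ` is valid. -/
@[simp] lemma realize_closure (φ : NFormula L n) (s : Fin n → A) :
    φ.closure.Realize s ↔ φ.ValidIn A := by
  simp [closure, realize_allList, ValidIn]

@[simp] lemma voc_closure (φ : NFormula L n) : φ.closure.voc = φ.voc := voc_allList _ _

/-- Renaming of all variables, free and bound, along a permutation. -/
def rename (σ : Equiv.Perm (Fin n)) : NFormula L n → NFormula L n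
  | falsum => falsum
  | equal i j => equal (σ i) (σ j)
  | rel R t => rel R (σ ∘ t)
  | imp φ ψ => imp (φ.rename σ) (ψ.rename σ)
  | all i φ => all (σ i) (φ.rename σ)

@[simp] lemma realize_rename (σ : Equiv.Perm (Fin n)) (φ : NFormula L n) (s : Fin n → A) :
    (φ.rename σ).Realize s ↔ φ.Realize (s ∘ σ) := by
  induction φ generalizing s with
  | falsum => rfl
  | equal i j => rfl
  | rel R t => rfl
  | imp φ ψ hφ hψ => exact imp_congr (hφ s) (hψ s)
  | all i φ h =>
    refine forall_congr' fun a => (h _).trans ?_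
    rw [Function.update_comp_eq_of_injective _ σ.injective]

@[simp] lemma voc_rename (σ : Equiv.Perm (Fin n)) (φ : NFormula L n) :
    (φ.rename σ).voc = φ.voc := by
  induction φ with
  | falsum => rfl
  | equal i j => rfl
  | rel R t => rfl
  | imp φ ψ hφ hψ => simp [rename, hφ, hψ]
  | all i φ h => exact h

end NFormula

open NFormula

/-! ### Types of tuples and back-and-forth -/

/-- The tuples `s` in `A` and `z` in `B` have the same kernel, and corresponding entries lie in `U`
and in `W` simultaneously. This is `Sim` for tuples that live in two different structures. -/
def SameType {A : Type w₁} {B : Type w₂} (U : Set A) (W : Set B) {k : ℕ}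
    (s : Fin k → A) (z : Fin k → B) : Prop :=
  (∀ i j, s i = s j ↔ z i = z j) ∧ ∀ i, s i ∈ U ↔ z i ∈ W

namespace SameType

variable {A : Type w₁} {B : Type w₂} {C : Type w₃} {U : Set A} {W : Set B} {Y : Set C} {k n : ℕ}

lemma symm {s : Fin k → A} {z : Fin k → B} (h : SameType U W s z) : SameType W U z s :=
  ⟨fun i j => (h.1 i j).symm, fun i => (h.2 i).symm⟩

lemma trans {s : Fin k → A} {z : Fin k → B} {x : Fin k → C} (h : SameType U W s z)
    (h' : SameType W Y z x) : SameType U Y s x :=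
  ⟨fun i j => (h.1 i j).trans (h'.1 i j), fun i => (h.2 i).trans (h'.2 i)⟩

lemma comp {s : Fin n → A} {z : Fin n → B} (h : SameType U W s z) (t : Fin k → Fin n) :
    SameType U W (s ∘ t) (z ∘ t) :=
  ⟨fun i j => h.1 (t i) (t j), fun i => h.2 (t i)⟩

lemma compl {s : Fin k → A} {z : Fin k → B} (h : SameType U W s z) : SameType Uᶜ Wᶜ s z :=
  ⟨h.1, fun i => not_congr (h.2 i)⟩

/-- The back-and-forth step: a change of one entry can be imitated in the other structure. The other
`n - 1` entries cannot exhaust a set with at least `n` elements. -/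
lemma exists_update {s : Fin n → A} {z : Fin n → B} (h : SameType U W s z) (i : Fin n) (a : A)
    (hW : a ∈ U → (n : ℕ∞) ≤ W.encard) (hW' : a ∉ U → (n : ℕ∞) ≤ Wᶜ.encard) :
    ∃ b, SameType U W (Function.update s i a) (Function.update z i b) := by
  by_cases ha : ∃ j, j ≠ i ∧ s j = a
  · obtain ⟨j, hj, rfl⟩ := ha
    refine ⟨z j, ?_⟩
    simpa [Function.comp_update] using h.comp (Function.update id i j)
  · have hfresh : ∀ Z : Set B, (n : ℕ∞) ≤ Z.encard → ∃ b ∈ Z, ∀ j, j ≠ i → z j ≠ b := by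
      intro Z hZ
      by_contra! hcon
      have hsub : Z ⊆ z '' {i}ᶜ := fun b hb => by
        obtain ⟨j, hj, hjb⟩ := hcon b hb
        exact ⟨j, hj, hjb⟩
      have hlt : (z '' ({i}ᶜ : Set (Fin n))).encard < n := by
        refine (Set.encard_image_le _ _).trans_lt ?_
        have h1 : ({i}ᶜ : Set (Fin n)) = ↑(({i} : Finset (Fin n))ᶜ) := by simp
        rw [h1, Set.encard_coe_eq_coe_finsetCard, Finset.card_compl]
        have := i.pos
        simp only [Fintype.card_fin, Finset.card_singleton, Nat.cast_lt]
        omega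
      exact absurd (hZ.trans (Set.encard_le_encard hsub)) (not_le.2 hlt)
    obtain ⟨b, hb, hbz⟩ : ∃ b, (a ∈ U ↔ b ∈ W) ∧ ∀ j, j ≠ i → z j ≠ b := by
      by_cases haU : a ∈ U
      · obtain ⟨b, hb, h'⟩ := hfresh W (hW haU)
        exact ⟨b, by simp [haU, hb], h'⟩
      · obtain ⟨b, hb, h'⟩ := hfresh Wᶜ (hW' haU)
        exact ⟨b, by simpa [haU] using hb, h'⟩
    push Not at ha
    refine ⟨b, fun p q => ?_, fun p => ?_⟩
    · by_cases hp : p = i <;> by_cases hq : q = i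
      · simp [hp, hq]
      · subst hp
        simp [hq, (ha q hq).symm, (hbz q hq).symm]
      · subst hq
        simp [hp, ha p hp, hbz p hp]
      · simp [hp, hq, h.1 p q]
    · by_cases hp : p = i
      · subst hp; simpa using hb
      · simpa [hp] using h.2 p

end SameType

/-- Every type of an `n`-tuple is realized over a core which, as well as its complement, has at
least `n` elements. -/
lemma exists_sameType {A : Type w₁} {B : Type w₂} (U : Set A) {W : Set B} {n : ℕ}
    (hW : (n : ℕ∞) ≤ W.encard) (hW' : (n : ℕ∞) ≤ Wᶜ.encard) (s : Fin n → A) :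
    ∃ z : Fin n → B, SameType U W s z := by
  have hemb : ∀ Z : Set B, (n : ℕ∞) ≤ Z.encard → ∃ f : Fin n → B, Function.Injective f ∧
      ∀ i, f i ∈ Z := fun Z hZ => by
    obtain ⟨T, hT, hcard⟩ := Set.exists_subset_encard_eq hZ
    have hfin : T.Finite := Set.finite_of_encard_eq_coe hcard
    have := hfin.to_subtype
    have hc : Nat.card T = n := by
      rw [Nat.card_coe_set_eq, Set.ncard, hcard]; rfl
    exact ⟨fun i => ((Finite.equivFinOfCardEq hc).symm i : B),
      Subtype.val_injective.comp (Equiv.injective _), fun i => hT (Subtype.coe_prop _)⟩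
  obtain ⟨f, hf, hfW⟩ := hemb W hW
  obtain ⟨g, hg, hgW⟩ := hemb Wᶜ hW'
  classical
  let r : Fin n → Fin n := fun i => Set.rangeSplitting s ⟨s i, i, rfl⟩
  have hr : ∀ i, s (r i) = s i := fun i => Set.apply_rangeSplitting s ⟨s i, i, rfl⟩
  have hr' : ∀ i j, s i = s j → r i = r j := fun i j hij => by simp only [r, hij]
  refine ⟨fun i => if s i ∈ U then f (r i) else g (r i), fun i j => ⟨fun hij => ?_, fun hij => ?_⟩,
    fun i => ?_⟩
  · simp only [hij, hr' i j hij]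
  · have hcl : r i = r j := by
      by_cases hi : s i ∈ U <;> by_cases hj : s j ∈ U <;> simp only [hi, hj, if_true, if_false] at hij
      · exact hf hij
      · exact absurd (hij ▸ hfW (r i)) (hgW (r j))
      · exact absurd (hij ▸ hfW (r j)) (hgW (r i))
      · exact hg hij
    rw [← hr i, ← hr j, hcl]
  · by_cases hi : s i ∈ U
    · simp [hi, hfW]
    · simpa [hi] using hgW (r i)

variable {L : FirstOrder.Language.{u, v}} {n : ℕ} {A : Type w₁} {B : Type w₂} {C : Type w₃}
  [L.Structure A] [L.Structure B] [L.Structure C] {U : Set A} {W : Set B} {Y : Set C}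
  {S V : Set (Symb L)}

/-- Formulas are invariant under any back-and-forth system of `n`-tuples that respects the atomic
formulas. -/
lemma realize_iff_of_backAndForth (E : (Fin n → A) → (Fin n → B) → Prop)
    (heq : ∀ s z, E s z → ∀ i j, s i = s j ↔ z i = z j)
    (hrel : ∀ s z, E s z → ∀ {k : ℕ} (R : L.Relations k), ⟨k, R⟩ ∈ S → ∀ t : Fin k → Fin n,
      (RelMap R (s ∘ t) ↔ RelMap R (z ∘ t)))
    (forth : ∀ s z, E s z → ∀ i a, ∃ b, E (Function.update s i a) (Function.update z i b))
    (back : ∀ s z, E s z → ∀ i b, ∃ a, E (Function.update s i a) (Function.update z i b))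
    (φ : NFormula L n) (hφ : φ.voc ⊆ S) {s : Fin n → A} {z : Fin n → B} (h : E s z) :
    φ.Realize s ↔ φ.Realize z := by
  induction φ generalizing s z with
  | falsum => rfl
  | equal i j => exact heq s z h i j
  | rel R t => exact hrel s z h R (hφ rfl) t
  | imp φ ψ ih₁ ih₂ =>
    exact imp_congr (ih₁ (Set.subset_union_left.trans hφ) h)
      (ih₂ (Set.subset_union_right.trans hφ) h)
  | all i φ ih =>
    refine ⟨fun H b => ?_, fun H a => ?_⟩
    · obtain ⟨a, ha⟩ := back s z h i b
      exact (ih hφ ha).1 (H a)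
    · obtain ⟨b, hb⟩ := forth s z h i a
      exact (ih hφ hb).2 (H b)

variable (n) in
/-- With respect to the cores `U` and `W`, the atomic formulas with a relation symbol in `S` hold at
the same types of `n`-tuples in `A` and in `B`. -/
def AgreeOn (S : Set (Symb L)) (U : Set A) (W : Set B) : Prop :=
  ∀ ⦃k : ℕ⦄ (R : L.Relations k), ⟨k, R⟩ ∈ S → ∀ (t : Fin k → Fin n) (s : Fin n → A)
    (z : Fin n → B), SameType U W s z → (RelMap R (s ∘ t) ↔ RelMap R (z ∘ t))

lemma AgreeOn.symm (h : AgreeOn n S U W) : AgreeOn n S W U :=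
  fun _ R hR t z s hsz => (h R hR t s z hsz.symm).symm

lemma AgreeOn.mono (h : AgreeOn n S U W) (hV : V ⊆ S) : AgreeOn n V U W :=
  fun _ R hR => h R (hV hR)

lemma AgreeOn.trans (h : AgreeOn n S U W) (h' : AgreeOn n S W Y)
    (hW : (n : ℕ∞) ≤ W.encard) (hW' : (n : ℕ∞) ≤ Wᶜ.encard) : AgreeOn n S U Y := by
  intro k R hR t s x hsx
  obtain ⟨z, hz⟩ := exists_sameType U hW hW' s
  exact (h R hR t s z hz).trans (h' R hR t z x (hz.symm.trans hsx))

namespace IsUStructure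

lemma agreeOn_self (hA : IsUStructure L n U) (S : Set (Symb L)) : AgreeOn n S U U :=
  fun _ R _ t _ _ hsz => ⟨fun h => hA.closed R _ _ h (hsz.comp t),
    fun h => hA.closed R _ _ h (hsz.symm.comp t)⟩

lemma compl (hA : IsUStructure L n U) : IsUStructure L n Uᶜ where
  le_core := hA.le_compl
  le_compl := by simpa using hA.le_core
  closed R s z h hsz := hA.closed R s z h
    ⟨hsz.1, fun i => by simpa [not_iff_not] using hsz.2 i⟩

lemma realize_iff (hA : IsUStructure L n U) (hB : IsUStructure L n W) (h : AgreeOn n S U W)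
    {φ : NFormula L n} (hφ : φ.voc ⊆ S) {s : Fin n → A} {z : Fin n → B} (hsz : SameType U W s z) :
    φ.Realize s ↔ φ.Realize z :=
  realize_iff_of_backAndForth (SameType U W) (fun _ _ hsz => hsz.1)
    (fun s z hsz _ R hR t => h R hR t s z hsz)
    (fun _ _ hsz i a => hsz.exists_update i a (fun _ => hB.le_core) fun _ => hB.le_compl)
    (fun _ _ hsz i b => by
      obtain ⟨a, ha⟩ := hsz.symm.exists_update i b (fun _ => hA.le_core) fun _ => hA.le_compl
      exact ⟨a, ha.symm⟩) φ hφ hsz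

lemma exists_sameType {D : Type*} (hB : IsUStructure L n W) (U : Set D) (s : Fin n → D) :
    ∃ z : Fin n → B, SameType U W s z :=
  UnaryLogic.exists_sameType U hB.le_core hB.le_compl s

lemma validIn_of_agreeOn (hA : IsUStructure L n U) (hB : IsUStructure L n W)
    (h : AgreeOn n S U W) {φ : NFormula L n} (hφ : φ.voc ⊆ S) (hv : φ.ValidIn A) :
    φ.ValidIn B := fun z => by
  obtain ⟨s, hs⟩ := hA.exists_sameType W z
  exact (hA.realize_iff hB h hφ hs.symm).1 (hv s)

lemma coreDefinableOver_of_agreeOn (hA : IsUStructure L n U) (hB : IsUStructure L n W)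
    (h : AgreeOn n V U W) (hV : CoreDefinableOver n V U) : CoreDefinableOver n V W := by
  obtain ⟨hn, φ, hφ, hdef⟩ := hV
  refine ⟨hn, φ, hφ, fun z => ?_⟩
  obtain ⟨s, hs⟩ := hA.exists_sameType W z
  exact (hA.realize_iff hB h hφ hs.symm).symm.trans ((hdef s).trans (hs.symm.2 _))

end IsUStructure

/-! ### Definable relations -/

lemma DefinableOver.mono {m : ℕ} {X : Set (Fin m → A)} (h : DefinableOver n S X) (hV : S ⊆ V) :
    DefinableOver n V X := by
  obtain ⟨hm, φ, hφ, hdef⟩ := h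
  exact ⟨hm, φ, hφ.trans hV, hdef⟩

lemma DefinableOver.compl {m : ℕ} {X : Set (Fin m → A)} (h : DefinableOver n V X) :
    DefinableOver n V Xᶜ := by
  obtain ⟨hm, φ, hφ, hdef⟩ := h
  exact ⟨hm, φ.neg, by simpa, fun s => not_congr (hdef s)⟩

lemma coreDefinableOver_compl : CoreDefinableOver n V Uᶜ ↔ CoreDefinableOver n V U :=
  ⟨fun h => by
    have h1 := DefinableOver.compl h
    have h2 : {x : Fin 1 → A | x 0 ∈ Uᶜ}ᶜ = {x : Fin 1 → A | x 0 ∈ U} := by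
      ext x; simp
    rwa [h2] at h1, fun h => DefinableOver.compl h⟩

/-- A relation with two of its coordinates exchanged is still definable: this permutes the variables
of the defining formula, and needs no additional ones. -/
lemma DefinableOver.swap {m : ℕ} {X : Set (Fin m → A)} (h : DefinableOver n V X) (i j : Fin m) :
    DefinableOver n V {s : Fin m → A | s ∘ Equiv.swap i j ∈ X} := by
  obtain ⟨hm, φ, hφ, hdef⟩ := h
  refine ⟨hm, φ.rename (Equiv.swap (Fin.castLE hm i) (Fin.castLE hm j)), by simpa, fun s => ?_⟩
  rw [realize_rename, hdef]
  refine iff_of_eq (congrArg (· ∈ X) (funext fun p => ?_))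
  simp only [Function.comp_apply]
  rw [(Fin.castLE_injective hm).map_swap]

lemma DefinableOver.exists_last {m : ℕ} {X : Set (Fin (m + 1) → A)} (h : DefinableOver n V X) :
    DefinableOver n V {s : Fin m → A | ∃ a, Fin.snoc (α := fun _ => A) s a ∈ X} := by
  obtain ⟨hm, φ, hφ, hdef⟩ := h
  refine ⟨by omega, φ.ex (Fin.castLE hm (Fin.last m)), by simpa, fun s => ?_⟩
  rw [realize_ex]
  refine exists_congr fun a => ?_
  rw [hdef]
  refine iff_of_eq (congrArg (· ∈ X) (funext fun p => ?_))
  induction p using Fin.lastCases with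
  | last => simp
  | cast p =>
    rw [Fin.snoc_castSucc, Function.update_of_ne]
    · rfl
    · exact fun hp => p.castSucc_lt_last.ne (Fin.castLE_injective hm hp)

/-- A retraction of `Fin n` onto an initial segment; it extends short tuples to evaluations. -/
lemma exists_comp_castLE {m : ℕ} (hm : m + 1 ≤ n) :
    ∃ g : Fin n → Fin (m + 1), ∀ i, g (Fin.castLE hm i) = i :=
  ⟨fun i => if h : i.1 < m + 1 then ⟨i, h⟩ else 0, fun i => by simp [i.2]⟩

lemma DefinableOver.mem_of_sim {m : ℕ} {X : Set (Fin m → A)} (h : DefinableOver n V X)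
    (hA : IsUStructure L n U) {s z : Fin m → A} (hs : s ∈ X) (hsz : Sim U s z) : z ∈ X := by
  cases m with
  | zero => rwa [Subsingleton.elim z s]
  | succ m =>
    obtain ⟨hm, φ, hφ, hdef⟩ := h
    obtain ⟨g, hg⟩ := exists_comp_castLE hm
    have h1 := hA.realize_iff hA (hA.agreeOn_self V) hφ (SameType.comp hsz g)
    rw [hdef, hdef] at h1
    simpa [hg] using h1.1 (by simpa [hg] using hs)

/-! ### Strong structures -/

variable (n) in
/-- The truth of the atomic formulas with a relation symbol in `V` depends only on the kernel of the
evaluation. -/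
def AtomsTrivial (V : Set (Symb L)) (A : Type w₁) [L.Structure A] : Prop :=
  ∀ ⦃k : ℕ⦄ (R : L.Relations k), ⟨k, R⟩ ∈ V → ∀ (t : Fin k → Fin n) (s z : Fin n → A),
    (∀ i j, s i = s j ↔ z i = z j) → RelMap R (s ∘ t) → RelMap R (z ∘ t)

/-- If the atomic formulas over `V` depend on the kernel only, then so do all formulas over `V`. -/
lemma AtomsTrivial.realize_iff (h : AtomsTrivial n V A) (hA : IsUStructure L n U)
    {φ : NFormula L n} (hφ : φ.voc ⊆ V) {s z : Fin n → A} (hsz : ∀ i j, s i = s j ↔ z i = z j) :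
    φ.Realize s ↔ φ.Realize z := by
  have hu : (n : ℕ∞) ≤ (Set.univ : Set A).encard :=
    hA.le_core.trans (Set.encard_le_encard (Set.subset_univ _))
  -- With the whole universe in place of the core, a type is just a kernel.
  refine realize_iff_of_backAndForth (S := V) (SameType Set.univ Set.univ) (fun _ _ h => h.1)
    (fun s z hsz _ R hR t => ⟨h R hR t s z hsz.1, h R hR t z s hsz.symm.1⟩)
    (fun _ _ hsz i a => hsz.exists_update i a (fun _ => hu) fun ha => absurd trivial ha)
    (fun _ _ hsz i b => ?_) φ hφ ⟨hsz, fun _ => Iff.rfl⟩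
  obtain ⟨a, ha⟩ := hsz.symm.exists_update i b (fun _ => hu) fun ha => absurd trivial ha
  exact ⟨a, ha.symm⟩

lemma AtomsTrivial.of_agreeOn (h : AtomsTrivial n V A) (hA : IsUStructure L n U)
    (hAB : AgreeOn n V U W) : AtomsTrivial n V B := by
  intro k R hR t s z hsz hs
  obtain ⟨s', hs'⟩ := hA.exists_sameType W s
  obtain ⟨z', hz'⟩ := hA.exists_sameType W z
  exact (hAB R hR t z' z hz'.symm).1 (h R hR t s' z'
    (fun i j => (hs'.symm.1 i j).trans ((hsz i j).trans (hz'.1 i j)))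
    ((hAB R hR t s' s hs'.symm).2 hs))

/-- A definable relation of injective tuples is then either empty or contains all of them, and the
condition on strong structures is immediate. -/
lemma IsUStructure.isStrong_of_atomsTrivial (hA : IsUStructure L n U)
    (h : ∀ V : Set (Symb L), ¬ CoreDefinableOver n V U → AtomsTrivial n V A) :
    IsStrongUStructure L n U where
  toIsUStructure := hA
  strong V hV m X hX hinj i j hij s := by
    refine ⟨fun hs => ⟨⟨s i, by simpa⟩, ⟨s j, by simpa⟩, hinj s hs⟩, fun ⟨⟨a, ha⟩, _, hs⟩ => ?_⟩
    cases m with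
    | zero => exact i.elim0
    | succ m =>
      obtain ⟨hm, φ, hφ, hdef⟩ := hX
      obtain ⟨g, hg⟩ := exists_comp_castLE hm
      have h1 := (h V hV).realize_iff hA hφ (s := Function.update s i a ∘ g) (z := s ∘ g)
        fun p q => ((hinj _ ha).eq_iff).trans hs.eq_iff.symm
      rw [hdef, hdef] at h1
      simpa [hg] using h1.1 (by simpa [hg] using ha)

namespace IsStrongUStructure

lemma compl (hA : IsStrongUStructure L n U) : IsStrongUStructure L n Uᶜ where
  toIsUStructure := hA.toIsUStructure.compl
  strong V hV := hA.strong V (by rwa [coreDefinableOver_compl] at hV)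

/-- If the core is not definable over `V`, a non-empty relation of injective tuples definable over
`V` contains all injective tuples. By induction on the arity: a unary exception would be the core or
its complement, and in higher arity the relation is determined by two of its projections. -/
lemma mem_of_injective (hA : IsStrongUStructure L n U) (hV : ¬ CoreDefinableOver n V U) {m : ℕ}
    {X : Set (Fin m → A)} (hX : DefinableOver n V X) (hinj : ∀ s ∈ X, Function.Injective s)
    (hne : X.Nonempty) {s : Fin m → A} (hs : Function.Injective s) : s ∈ X := by
  induction m with
  | zero =>
    obtain ⟨x, hx⟩ := hne
    rwa [Subsingleton.elim s x]
  | succ m ih =>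
    cases m with
    | zero =>
      obtain ⟨x, hx⟩ := hne
      by_contra hsX
      -- Membership depends only on lying in the core; as `x ∈ X` and `s ∉ X`, one of `X` and `Xᶜ`
      -- is the core.
      have hmem : ∀ {y y' : Fin 1 → A}, y ∈ X → (y 0 ∈ U ↔ y' 0 ∈ U) → y' ∈ X := fun hy h =>
        hX.mem_of_sim hA.toIsUStructure hy
          ⟨fun i j => by simp [Fin.fin_one_eq_zero], fun i => by rwa [Fin.fin_one_eq_zero i]⟩
      have hxs : ¬ (x 0 ∈ U ↔ s 0 ∈ U) := fun h => hsX (hmem hx h)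
      by_cases hxU : x 0 ∈ U
      · refine hV ?_
        rw [CoreDefinableOver]
        convert hX using 1
        ext y
        refine ⟨fun hy => hmem hx (iff_of_true hxU hy), fun hy => ?_⟩
        by_contra hyU
        exact hsX (hmem hy (iff_of_false hyU fun h => hxs (iff_of_true hxU h)))
      · refine hV ?_
        rw [CoreDefinableOver]
        convert hX.compl using 1
        ext y
        refine ⟨fun hy hyX => hsX (hmem hyX (iff_of_true hy ?_)), fun hy => ?_⟩
        · by_contra h
          exact hxs (iff_of_false hxU h)
        · by_contra hyU
          exact hy (hmem hx (iff_of_false hxU hyU))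
    | succ m =>
      -- By induction the projection of a non-empty relation along its last entry is everything.
      have hproj : ∀ X : Set (Fin (m + 2) → A), DefinableOver n V X →
          (∀ s ∈ X, Function.Injective s) → X.Nonempty → ∀ s : Fin (m + 2) → A,
          Function.Injective s → ∃ a, Function.update s (Fin.last _) a ∈ X := by
        intro X hX hinj ⟨x, hx⟩ s hs
        have h1 := ih hX.exists_last (s := Fin.init s)
          (fun y ⟨a, ha⟩ p q hpq => by
            have := @hinj _ ha p.castSucc q.castSucc
            simpa [hpq] using this)
          ⟨Fin.init x, x (Fin.last _), by simpa using hx⟩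
          (fun p q hpq => by simpa using hs hpq)
        obtain ⟨a, ha⟩ := h1
        refine ⟨a, ?_⟩
        rw [← Fin.snoc_init_self s, Fin.update_snoc_last]
        exact ha
      have h0 : ((0 : Fin (m + 2))) ≠ Fin.last _ := (Fin.last_pos).ne
      refine (hA.strong V hV _ X hX hinj (Fin.last _) 0 h0.symm s).2
        ⟨hproj X hX hinj hne s hs, ?_, hs⟩
      -- The projection along the first entry is that of the relation with these entries swapped.
      set σ := Equiv.swap (0 : Fin (m + 2)) (Fin.last _) with hσ
      have hσσ : ∀ x : Fin (m + 2) → A, (x ∘ σ) ∘ σ = x := fun x => by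
        ext p; simp [hσ]
      obtain ⟨a, ha⟩ := hproj {s | s ∘ σ ∈ X} (hX.swap _ _)
        (fun y hy => by
          have := (hinj _ hy).comp σ.injective
          rwa [hσσ] at this)
        (by obtain ⟨x, hx⟩ := hne
            exact ⟨x ∘ σ, by simpa [hσσ] using hx⟩)
        (s ∘ σ) (hs.comp σ.injective)
      refine ⟨a, ?_⟩
      have hl : σ 0 = Fin.last _ := Equiv.swap_apply_left _ _
      rw [← hl, Set.mem_ofPred_eq, Function.update_comp_eq_of_injective _ σ.injective, hσσ] at ha
      exact ha

/-- The substance of strength. An atomic formula evaluated at tuples of a fixed kernel with `m`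
classes is an `m`-ary relation of injective tuples, definable by the atomic formula with its variables
identified. -/
lemma atomsTrivial (hA : IsStrongUStructure L n U) (hV : ¬ CoreDefinableOver n V U) :
    AtomsTrivial n V A := by
  intro k R hR t s z hsz hs
  -- Factor `s = s' ∘ f` and `z = z' ∘ f` through the quotient by the common kernel.
  have hcard : Nat.card (Set.range s) ≤ n := by
    simpa using Finite.card_range_le s
  set m := Nat.card (Set.range s) with hm
  let e : Set.range s ≃ Fin m := Finite.equivFin _
  let f : Fin n → Fin m := fun i => e ⟨s i, i, rfl⟩
  let r : Fin m → Fin n := fun c => Set.rangeSplitting s (e.symm c)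
  have hfr : ∀ c, f (r c) = c := fun c => by
    simp [f, r, Set.apply_rangeSplitting]
  have hf : ∀ i j, f i = f j ↔ s i = s j := fun i j =>
    e.injective.eq_iff.trans Subtype.mk_eq_mk
  have hsr : (s ∘ r) ∘ f = s := funext fun i => (hf _ _).1 (hfr _)
  have hzr : (z ∘ r) ∘ f = z := funext fun i => (hsz _ _).1 ((hf _ _).1 (hfr _))
  have hsi : Function.Injective (s ∘ r) := fun c d h => by
    rw [← hfr c, ← hfr d]; exact (hf _ _).2 h
  have hzi : Function.Injective (z ∘ r) := fun c d h => by
    rw [← hfr c, ← hfr d]; exact (hf _ _).2 ((hsz _ _).2 h)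
  let X : Set (Fin m → A) := {x | Function.Injective x ∧ RelMap R ((x ∘ f) ∘ t)}
  have hX : DefinableOver n V X := by
    let χ : Fin m × Fin m → NFormula L n := fun p =>
      signed (p.1 = p.2) (equal (Fin.castLE hcard p.1) (Fin.castLE hcard p.2))
    refine ⟨hcard, (conj χ).and (rel R (Fin.castLE hcard ∘ f ∘ t)), ?_, fun x => ?_⟩
    · rw [voc_and]
      refine Set.union_subset (voc_conj fun p => ?_) ?_
      · simp [χ, voc]
      · simpa [voc] using hR
    · rw [realize_and, realize_conj, realize_rel]
      refine and_congr ⟨fun h p q hpq => ?_, fun h p => ?_⟩ Iff.rfl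
      · exact ((realize_signed _ _ _).1 (h (p, q))).2 hpq
      · exact (realize_signed _ _ _).2 ⟨fun hp => by simp [hp], fun hp => h hp⟩
  have := hA.mem_of_injective hV hX (fun x hx => hx.1)
    ⟨s ∘ r, hsi, by rwa [hsr]⟩ hzi
  simpa only [X, Set.mem_ofPred_eq, hzr] using this.2

end IsStrongUStructure

/-! ### Amalgamation of strong structures -/

/-- The universe of amalgams: a core and a complement, both infinite. -/
abbrev AmalgamType : Type w := ULift.{w} (Bool × ℕ)

/-- The core of the amalgam. -/
def amalgamCore : Set AmalgamType.{w} := {d | d.down.1 = true}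

lemma encard_fiber (n : ℕ) (b : Bool) : (n : ℕ∞) ≤ {d : AmalgamType.{w} | d.down.1 = b}.encard := by
  have h : {d : AmalgamType.{w} | d.down.1 = b}.Infinite :=
    Set.infinite_of_injective_forall_mem (f := fun k : ℕ => (⟨(b, k)⟩ : AmalgamType.{w}))
      (fun k l hkl => by simpa using hkl) fun k => rfl
  simp [h.encard_eq]

/-- The amalgam of `A` and `B` takes the relations with a symbol in `S` from `A` and all others
from `B`: a tuple is in a relation iff its type is the type of some member of the original
relation. -/
@[reducible]
def amalgamStructure [L.IsRelational] (S : Set (Symb L)) (U : Set A) (W : Set B) :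
    L.Structure AmalgamType.{w} where
  funMap f := isEmptyElim f
  RelMap {k} R x := (⟨k, R⟩ ∈ S ∧ ∃ s : Fin k → A, RelMap R s ∧ SameType U amalgamCore s x) ∨
    (⟨k, R⟩ ∉ S ∧ ∃ z : Fin k → B, RelMap R z ∧ SameType W amalgamCore z x)

/-- If the core of `C` is not definable over `V`, then the core is definable neither over `V ∩ S` in
`A` nor over `V \ S` in `B`; so both parts of the vocabulary have trivial atomic formulas, and `C` is strong. -/
lemma IsUStructure.isStrong_of_agreeOn (hC : IsUStructure L n Y) (hA : IsStrongUStructure L n U)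
    (hB : IsStrongUStructure L n W) (hAC : AgreeOn n S U Y) (hBC : AgreeOn n Sᶜ W Y) :
    IsStrongUStructure L n Y := by
  refine hC.isStrong_of_atomsTrivial fun V hV => ?_
  have h1 : AtomsTrivial n (V ∩ S) C := by
    have hag := hAC.mono (Set.inter_subset_right (s := V))
    refine (hA.atomsTrivial fun h => hV ?_).of_agreeOn hA.toIsUStructure hag
    exact (hA.coreDefinableOver_of_agreeOn hC hag h).mono Set.inter_subset_left
  have h2 : AtomsTrivial n (V ∩ Sᶜ) C := by
    have hag := hBC.mono (Set.inter_subset_right (s := V))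
    refine (hB.atomsTrivial fun h => hV ?_).of_agreeOn hB.toIsUStructure hag
    exact (hB.coreDefinableOver_of_agreeOn hC hag h).mono Set.inter_subset_left
  intro k R hR
  by_cases hS : (⟨k, R⟩ : Symb L) ∈ S
  · exact h1 R ⟨hR, hS⟩
  · exact h2 R ⟨hR, hS⟩

lemma exists_amalgam [L.IsRelational] (hA : IsStrongUStructure L n U)
    (hB : IsStrongUStructure L n W) (S : Set (Symb L)) :
    ∃ (C : Type w) (_ : Nonempty C) (_ : L.Structure C) (Y : Set C),
      IsStrongUStructure L n Y ∧ AgreeOn n S U Y ∧ AgreeOn n Sᶜ W Y := by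
  let _ : L.Structure AmalgamType.{w} := amalgamStructure S U W
  have hrel : ∀ {k : ℕ} (R : L.Relations k) (x : Fin k → AmalgamType.{w}), RelMap R x ↔
      (⟨k, R⟩ ∈ S ∧ ∃ s : Fin k → A, RelMap R s ∧ SameType U amalgamCore s x) ∨
      (⟨k, R⟩ ∉ S ∧ ∃ z : Fin k → B, RelMap R z ∧ SameType W amalgamCore z x) :=
    fun _ _ => Iff.rfl
  have hC : IsUStructure L n amalgamCore.{w} :=
    { le_core := encard_fiber n true
      le_compl := by
        convert encard_fiber n false using 2
        ext d; simp [amalgamCore]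
      closed := fun R x y hx hxy => by
        rw [hrel] at hx ⊢
        exact hx.imp (And.imp_right fun ⟨s, hs, h⟩ => ⟨s, hs, h.trans hxy⟩)
          (And.imp_right fun ⟨s, hs, h⟩ => ⟨s, hs, h.trans hxy⟩) }
  have hAC : AgreeOn n S U amalgamCore.{w} := fun k R hR t s x hsx => by
    rw [hrel]
    refine ⟨fun h => Or.inl ⟨hR, _, h, hsx.comp t⟩, fun h => ?_⟩
    obtain ⟨_, s', hs', h⟩ | ⟨h, _⟩ := h
    · exact hA.closed R _ _ hs' (h.trans (hsx.comp t).symm)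
    · exact absurd hR h
  have hBC : AgreeOn n Sᶜ W amalgamCore.{w} := fun k R hR t s x hsx => by
    rw [hrel]
    refine ⟨fun h => Or.inr ⟨hR, _, h, hsx.comp t⟩, fun h => ?_⟩
    obtain ⟨h, _⟩ | ⟨_, s', hs', h⟩ := h
    · exact absurd h hR
    · exact hB.closed R _ _ hs' (h.trans (hsx.comp t).symm)
  exact ⟨AmalgamType.{w}, ⟨⟨(true, 0)⟩⟩, inferInstance, amalgamCore,
    hC.isStrong_of_agreeOn hA hB hAC hBC, hAC, hBC⟩

/-! ### Equivalent strong structures agree up to an exchange of the core and its complement -/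

/-- The formula saying that the evaluation has the same kernel as `s`. -/
noncomputable def kernelFormula (L : FirstOrder.Language.{u, v}) (s : Fin n → A) : NFormula L n :=
  conj fun p : Fin n × Fin n => signed (s p.1 = s p.2) (equal p.1 p.2)

omit [L.Structure A] in
lemma realize_kernelFormula (s : Fin n → A) (x : Fin n → B) :
    (kernelFormula L s).Realize x ↔ ∀ i j, s i = s j ↔ x i = x j := by
  simp [kernelFormula]

omit [L.Structure A] in
lemma voc_kernelFormula (s : Fin n → A) : (kernelFormula L s).voc ⊆ V :=
  voc_conj fun p => by simp [voc]

/-- For trivial atomic formulas, the kernels at which they hold can be read off from the valid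
formulas, and the cores are irrelevant. -/
lemma AtomsTrivial.agreeOn (hA : AtomsTrivial n V A) (hB : AtomsTrivial n V B)
    (hAB : ∀ χ : NFormula L n, χ.voc ⊆ V → (χ.ValidIn A ↔ χ.ValidIn B)) (U : Set A) (W : Set B) :
    AgreeOn n V U W := by
  intro k R hR t s z hsz
  have hvoc : (rel R t : NFormula L n).voc ⊆ V := by simpa [voc] using hR
  constructor <;> intro h
  · refine (hAB ((kernelFormula L s).imp (rel R t))
      (Set.union_subset (voc_kernelFormula s) hvoc)).1 (fun x hx => ?_) z
      ((realize_kernelFormula s z).2 hsz.1)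
    exact hA R hR t s x ((realize_kernelFormula s x).1 hx) h
  · refine (hAB ((kernelFormula L z).imp (rel R t))
      (Set.union_subset (voc_kernelFormula z) hvoc)).2 (fun x hx => ?_) s
      ((realize_kernelFormula z s).2 hsz.symm.1)
    exact hB R hR t z x ((realize_kernelFormula z x).1 hx) h

/-- If `δ` defines the core, this formula says that the evaluation has the same type as `s`. -/
noncomputable def typeFormula (δ : NFormula L n) (i₀ : Fin n) (U : Set A) (s : Fin n → A) :
    NFormula L n :=
  (kernelFormula L s).and (conj fun i => signed (s i ∈ U) (δ.rename (Equiv.swap i₀ i)))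

omit [L.Structure A] in
lemma realize_typeFormula {δ : NFormula L n} {i₀ : Fin n}
    (hδ : ∀ x : Fin n → B, δ.Realize x ↔ x i₀ ∈ W) (s : Fin n → A) (x : Fin n → B) :
    (typeFormula δ i₀ U s).Realize x ↔ SameType U W s x := by
  simp [typeFormula, realize_kernelFormula, hδ, SameType]

omit [L.Structure A] in
lemma voc_typeFormula {δ : NFormula L n} (hδ : δ.voc ⊆ V) (i₀ : Fin n) (U : Set A)
    (s : Fin n → A) : (typeFormula δ i₀ U s).voc ⊆ V := by
  rw [typeFormula, voc_and]
  exact Set.union_subset (voc_kernelFormula s) (voc_conj fun i => by simpa using hδ)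

lemma agreeOn_of_defines_core (hA : IsUStructure L n U) (hB : IsUStructure L n W)
    (hAB : ∀ χ : NFormula L n, χ.voc ⊆ V → (χ.ValidIn A ↔ χ.ValidIn B))
    {δ : NFormula L n} (hδ : δ.voc ⊆ V) {i₀ : Fin n} (hδA : ∀ x : Fin n → A, δ.Realize x ↔ x i₀ ∈ U)
    (hδB : ∀ x : Fin n → B, δ.Realize x ↔ x i₀ ∈ W) : AgreeOn n V U W := by
  intro k R hR t s z hsz
  have hvoc : (rel R t : NFormula L n).voc ⊆ V := by simpa [voc] using hR
  constructor <;> intro h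
  · refine (hAB ((typeFormula δ i₀ U s).imp (rel R t))
      (Set.union_subset (voc_typeFormula hδ i₀ U s) hvoc)).1 (fun x hx => ?_) z
      ((realize_typeFormula hδB s z).2 hsz)
    exact hA.closed R _ _ h (((realize_typeFormula hδA s x).1 hx).comp t)
  · refine (hAB ((typeFormula δ i₀ W z).imp (rel R t))
      (Set.union_subset (voc_typeFormula hδ i₀ W z) hvoc)).2 (fun x hx => ?_) s
      ((realize_typeFormula hδA z s).2 hsz.symm)
    exact hB.closed R _ _ h (((realize_typeFormula hδB z x).1 hx).comp t)

/-- A formula that defines the core of `A` defines in `B` a set of elements that is neither empty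
nor everything and is closed under `Sim`: the core or its complement. -/
lemma agreeOn_or_agreeOn_compl_of_coreDefinable (hA : IsUStructure L n U)
    (hB : IsUStructure L n W)
    (hAB : ∀ χ : NFormula L n, χ.voc ⊆ V → (χ.ValidIn A ↔ χ.ValidIn B))
    (hV : CoreDefinableOver n V U) : AgreeOn n V U W ∨ AgreeOn n V U Wᶜ := by
  obtain ⟨hn, δ₀, hδ₀, hdef⟩ := hV
  set i₀ : Fin n := Fin.castLE hn 0 with hi₀
  replace hdef : ∀ s : Fin n → A, δ₀.Realize s ↔ s i₀ ∈ U := hdef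
  -- Quantify away all other variables, so that the truth of `δ` depends only on the value of `i₀`
  -- in `B` as well.
  let δ := allList ((List.finRange n).filter (· ≠ i₀)) δ₀
  have hδ : δ.voc ⊆ V := by simpa [δ] using hδ₀
  have hδr : ∀ {D : Type _} [L.Structure D] (s : Fin n → D),
      δ.Realize s ↔ ∀ z : Fin n → D, z i₀ = s i₀ → δ₀.Realize z := fun s => by
    simp [δ, realize_allList]
  have hδA : ∀ s : Fin n → A, δ.Realize s ↔ s i₀ ∈ U := fun s => by
    simp only [δ, realize_allList, hdef]
    exact ⟨fun h => h s fun _ _ => rfl, fun h z hz => by rwa [hz i₀ (by simp)]⟩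
  have hδB : ∀ s z : Fin n → B, (s i₀ ∈ W ↔ z i₀ ∈ W) → δ.Realize s → δ.Realize z :=
    fun s z h hs => by
      have h1 := hB.realize_iff hB (hB.agreeOn_self V) hδ
        (s := fun _ => s i₀) (z := fun _ => z i₀) ⟨by simp, fun _ => h⟩
      have h2 : ∀ y : Fin n → B, δ.Realize y ↔ δ.Realize fun _ => y i₀ := fun y => by
        rw [hδr, hδr]
      exact (h2 z).2 (h1.1 ((h2 s).1 hs))
  have hpos : 0 < n := i₀.pos
  have hne : ∀ Z : Set A, (n : ℕ∞) ≤ Z.encard → ∃ a, a ∈ Z := fun Z hZ => by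
    rw [← Set.Nonempty, ← Set.encard_ne_zero]
    exact (lt_of_lt_of_le (by exact_mod_cast hpos) hZ).ne'
  obtain ⟨a, ha⟩ := hne U hA.le_core
  obtain ⟨a', ha'⟩ := hne Uᶜ hA.le_compl
  have hex : ∃ z : Fin n → B, δ.Realize z := by
    by_contra! h
    exact (hAB δ.neg (by simpa)).2 h (fun _ => a) ((hδA _).2 ha)
  have hex' : ∃ z : Fin n → B, ¬ δ.Realize z := by
    by_contra! h
    exact ha' ((hδA fun _ => a').1 ((hAB δ hδ).2 h _))
  obtain ⟨z, hz⟩ := hex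
  obtain ⟨z', hz'⟩ := hex'
  have hzz' : ¬ (z i₀ ∈ W ↔ z' i₀ ∈ W) := fun h => hz' (hδB z z' h hz)
  by_cases hzW : z i₀ ∈ W
  · left
    refine agreeOn_of_defines_core hA hB hAB hδ hδA fun x => ⟨fun hx => ?_, fun hx => ?_⟩
    · by_contra hxW
      exact hz' (hδB x z' (by tauto) hx)
    · exact hδB z x (by tauto) hz
  · right
    refine agreeOn_of_defines_core hA hB.compl hAB hδ hδA fun x => ⟨fun hx hxW => ?_, fun hx => ?_⟩
    · exact hz' (hδB x z' (by tauto) hx)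
    · exact hδB z x (iff_of_false hzW hx) hz

lemma AgreeOn.compl (h : AgreeOn n S U W) : AgreeOn n S Uᶜ Wᶜ := fun _ R hR t s z hsz =>
  h R hR t s z (by simpa using hsz.compl)

lemma IsStrongUStructure.agreeOn_or_agreeOn_compl
    (hA : IsStrongUStructure L n U) (hB : IsStrongUStructure L n W)
    (hAB : ∀ χ : NFormula L n, χ.voc ⊆ V → (χ.ValidIn A ↔ χ.ValidIn B)) :
    AgreeOn n V U W ∨ AgreeOn n V U Wᶜ := by
  by_cases hVA : CoreDefinableOver n V U
  · exact agreeOn_or_agreeOn_compl_of_coreDefinable hA.toIsUStructure hB.toIsUStructure hAB hVA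
  by_cases hVB : CoreDefinableOver n V W
  · refine (agreeOn_or_agreeOn_compl_of_coreDefinable hB.toIsUStructure hA.toIsUStructure
      (fun χ hχ => (hAB χ hχ).symm) hVB).imp AgreeOn.symm fun h => ?_
    simpa using h.symm.compl
  · exact Or.inl ((hA.atomsTrivial hVA).agreeOn (hB.atomsTrivial hVB) hAB U W)

/-- A model of `φ` and a structure refuting `ψ` can be told apart in the common vocabulary; otherwise
their amalgam would satisfy `φ` and refute `ψ`. -/
lemma exists_separating [L.IsRelational] {A B : Type w} [Nonempty A] [Nonempty B] [L.Structure A]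
    [L.Structure B] {U : Set A} {W : Set B} (hA : IsStrongUStructure L n U)
    (hB : IsStrongUStructure L n W) {φ ψ : NFormula L n} (h : Entails.{u, v, w} φ ψ)
    (hφ : φ.ValidIn A) (hψ : ¬ ψ.ValidIn B) :
    ∃ χ : NFormula L n, χ.voc ⊆ φ.voc ∩ ψ.voc ∧ χ.ValidIn A ∧ ¬ χ.ValidIn B := by
  by_contra! hcon
  have hAB : ∀ χ : NFormula L n, χ.voc ⊆ φ.voc ∩ ψ.voc → (χ.ValidIn A ↔ χ.ValidIn B) := by
    refine fun χ hχ => ⟨hcon χ hχ, fun hv => ?_⟩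
    by_contra hnv
    have h1 := hcon χ.closure.neg (by simpa using hχ) fun s hs => hnv (by simpa using hs)
    obtain ⟨b⟩ := ‹Nonempty B›
    exact h1 (fun _ => b) (by simpa using hv)
  -- After exchanging the core of `B` with its complement, the common atomic formulas agree.
  obtain ⟨W', hB', hag⟩ : ∃ W' : Set B, IsStrongUStructure L n W' ∧
      AgreeOn n (φ.voc ∩ ψ.voc) U W' :=
    (hA.agreeOn_or_agreeOn_compl hB hAB).elim (fun h => ⟨W, hB, h⟩) fun h => ⟨Wᶜ, hB.compl, h⟩
  obtain ⟨C, _, _, Y, hC, hAC, hBC⟩ := exists_amalgam.{u, v, w} hA hB' φ.voc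
  have hBC' : AgreeOn n ψ.voc W' Y := fun k R hR => by
    by_cases hS : (⟨k, R⟩ : Symb L) ∈ φ.voc
    · exact ((hag.symm.trans (hAC.mono Set.inter_subset_left) hA.le_core hA.le_compl)) R ⟨hS, hR⟩
    · exact hBC R hS
  refine hψ (hC.validIn_of_agreeOn hB'.toIsUStructure hBC'.symm subset_rfl ?_)
  exact h C Y hC (hA.validIn_of_agreeOn hC.toIsUStructure hAC subset_rfl hφ)

/-! ### Finitely many profiles, and the interpolant -/

/-- The type of an `n`-tuple: its kernel, and the set of its entries that lie in the core. -/
def tupleType {A : Type*} (U : Set A) (s : Fin n → A) : Set (Fin n × Fin n) × Set (Fin n) :=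
  ({p | s p.1 = s p.2}, {i | s i ∈ U})

omit [L.Structure A] [L.Structure B] in
lemma tupleType_eq_iff {s : Fin n → A} {z : Fin n → B} :
    tupleType U s = tupleType W z ↔ SameType U W s z := by
  simp [tupleType, SameType, Set.ext_iff]

/-- The possible profiles: sets of types for each atomic formula over `V`. -/
abbrev Profile (V : Set (Symb L)) (n : ℕ) : Type _ :=
  ∀ R : V, (Fin R.1.1 → Fin n) → Set (Set (Fin n × Fin n) × Set (Fin n))

/-- The profile of a structure assigns to each atomic formula over `V` the set of the types at which
it holds. -/
def profile (V : Set (Symb L)) (n : ℕ) (U : Set A) : Profile V n :=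
  fun R t => {τ | ∃ s : Fin n → A, RelMap R.1.2 (s ∘ t) ∧ tupleType U s = τ}

lemma IsUStructure.relMap_of_profile_eq (hB : IsUStructure L n W)
    (h : profile V n U = profile V n W) {k : ℕ} {R : L.Relations k} (hR : ⟨k, R⟩ ∈ V)
    (t : Fin k → Fin n) {s : Fin n → A} {z : Fin n → B} (hsz : SameType U W s z)
    (hs : RelMap R (s ∘ t)) : RelMap R (z ∘ t) := by
  have h1 : tupleType U s ∈ profile V n U ⟨⟨k, R⟩, hR⟩ t := ⟨s, hs, rfl⟩
  rw [h] at h1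
  obtain ⟨z', hz', heq⟩ := h1
  exact hB.closed R _ _ hz' (((tupleType_eq_iff.1 heq).trans hsz).comp t)

/-- The profile determines at which types the atomic formulas over `V` hold, and hence, by
`IsUStructure.validIn_of_agreeOn`, which formulas over `V` are valid. -/
lemma IsUStructure.agreeOn_of_profile_eq (hA : IsUStructure L n U) (hB : IsUStructure L n W)
    (h : profile V n U = profile V n W) : AgreeOn n V U W :=
  fun _ _ hR t _ _ hsz => ⟨hB.relMap_of_profile_eq h hR t hsz,
    hA.relMap_of_profile_eq h.symm hR t hsz.symm⟩

lemma exists_interpolant [L.IsRelational] {φ ψ : NFormula L n} (h : Entails.{u, v, w} φ ψ) :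
    ∃ θ : NFormula L n, θ.voc ⊆ φ.voc ∩ ψ.voc ∧ Entails.{u, v, w} φ θ ∧ Entails.{u, v, w} θ ψ := by
  set V := φ.voc ∩ ψ.voc
  have : Finite V := (φ.finite_voc.inter_of_left _).to_subtype
  -- The separating formula can be chosen for the profiles instead of the structures.
  have hsep : ∀ p q : Profile V n, ∃ χ : NFormula L n, χ.voc ⊆ V ∧
      ∀ (A : Type w) [Nonempty A] [L.Structure A] (U : Set A), IsStrongUStructure L n U →
      ∀ (B : Type w) [Nonempty B] [L.Structure B] (W : Set B), IsStrongUStructure L n W →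
      profile V n U = p → profile V n W = q → φ.ValidIn A → ¬ ψ.ValidIn B →
      χ.ValidIn A ∧ ¬ χ.ValidIn B := by
    intro p q
    by_cases hpq : ∃ (A : Type w) (_ : Nonempty A) (_ : L.Structure A) (U : Set A)
      (B : Type w) (_ : Nonempty B) (_ : L.Structure B) (W : Set B), IsStrongUStructure L n U ∧
      IsStrongUStructure L n W ∧ profile V n U = p ∧ profile V n W = q ∧ φ.ValidIn A ∧
      ¬ ψ.ValidIn B
    · obtain ⟨A, _, _, U, B, _, _, W, hA, hB, rfl, rfl, hφ, hψ⟩ := hpq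
      obtain ⟨χ, hχ, hχA, hχB⟩ := exists_separating hA hB h hφ hψ
      refine ⟨χ, hχ, fun A' _ _ U' hA' B' _ _ W' hB' hU' hW' _ _ => ⟨?_, fun hv => hχB ?_⟩⟩
      · exact hA.validIn_of_agreeOn hA'.toIsUStructure
          (hA.agreeOn_of_profile_eq hA'.toIsUStructure hU'.symm) hχ hχA
      · exact hB'.validIn_of_agreeOn hB.toIsUStructure
          (hB'.agreeOn_of_profile_eq hB.toIsUStructure hW') hχ hv
    · refine ⟨falsum, Set.empty_subset _, fun A _ _ U hA B _ _ W hB hU hW hφ hψ => ?_⟩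
      exact absurd ⟨A, ‹_›, ‹_›, U, B, ‹_›, ‹_›, W, hA, hB, hU, hW, hφ, hψ⟩ hpq
  choose χ hχV hχ using hsep
  let Good : Set (Profile V n) := {p | ∃ (A : Type w) (_ : Nonempty A) (_ : L.Structure A)
    (U : Set A), IsStrongUStructure L n U ∧ profile V n U = p ∧ φ.ValidIn A}
  let Bad : Set (Profile V n) := {q | ∃ (B : Type w) (_ : Nonempty B) (_ : L.Structure B)
    (W : Set B), IsStrongUStructure L n W ∧ profile V n W = q ∧ ¬ ψ.ValidIn B}
  refine ⟨disj fun p : Good => conj fun q : Bad => (χ p q).closure,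
    voc_disj fun p => voc_conj fun q => by simpa using hχV p q, ?_, ?_⟩
  · intro A _ _ U hA hφ s
    rw [realize_disj]
    refine ⟨⟨profile V n U, A, ‹_›, ‹_›, U, hA, rfl, hφ⟩, ?_⟩
    rw [realize_conj]
    rintro ⟨_, B, _, _, W, hB, rfl, hψ⟩
    exact (realize_closure _ _).2 (hχ _ _ A U hA B W hB rfl rfl hφ hψ).1
  · intro B _ _ W hB hθ
    by_contra hψ
    obtain ⟨b⟩ := ‹Nonempty B›
    have h1 := hθ fun _ => b
    rw [realize_disj] at h1
    obtain ⟨⟨_, A, _, _, U, hA, rfl, hφ⟩, h1⟩ := h1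
    rw [realize_conj] at h1
    have h2 := h1 ⟨profile V n W, B, ‹_›, ‹_›, W, hB, rfl, hψ⟩
    exact (hχ _ _ A U hA B W hB rfl rfl hφ hψ).2 ((realize_closure _ _).1 h2)

end UnaryLogic

theorem theorem3p3 (n : ℕ) (L : FirstOrder.Language.{u, v}) [L.IsRelational]
    (φ ψ : UnaryLogic.NFormula L n) (h : UnaryLogic.Entails.{u, v, w} φ ψ) :
    ∃ θ : UnaryLogic.NFormula L n, θ.voc ⊆ φ.voc ∩ ψ.voc ∧
      UnaryLogic.Entails.{u, v, w} φ θ ∧ UnaryLogic.Entails.{u, v, w} θ ψ :=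
  UnaryLogic.exists_interpolant h
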